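/- **Setting.** Let $I$ be a finite non-empty set with standard basis $(\alpha_i)_{i\in I}$ of $\mathbb Z^I$. A *semi-Cartan graph* $\mathcal G=(I,\mathcal X,(r_i)_{i\in I},(A^X)_{X\in\mathcal X})$ consists of a non-empty set $\mathcal X$, maps $r_i:\mathcal X\to\mathcal X$ with $r_i^2=\mathrm{id}$, and generalized Cartan matrices $A^X=(a^X_{ij})\in\mathbb Z^{I\times I}$ such that $A^X$ and $A^{r_i(X)}$ have the same $i$-th row. It is *standard* if $A^X$ does not depend on $X$; we then write $A=(a_{ij})$. Let $s_i^X\in\operatorname{Aut}(\mathbb Z^I)$, $s_i^X(\alpha_j)=\alpha_j-a^X_{ij}\alpha_i$. The *Weyl groupoid* $\mathcal W(\mathcal G)$ is the smallest category with object set $\mathcal X$ whose morphisms $X\to Y$ are triples $(Y,f,X)$, $f\in\operatorname{End}(\mathbb Z^I)$, with $(Z,g,Y)\circ(Y,f,X)=(Z,gf,X)$, that contains all $(r_i(X),s_i^X,X)$. $\mathcal G$ is *connected* (*simply connected*) if there is at least (at most) one morphism between any two objects. The set of *real roots* at $X$ is $\Delta^{X,\mathrm{re}}=\{w(\alpha_i)\mid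 i\in I,\ w \text{ a morphism with target } X\}$, and $m^X_{ij}=|\Delta^{X,\mathrm{re}}\cap(\mathbb N_0\alpha_i+\mathbb N_0\alpha_j)|$. $\mathcal G$ is a *Cartan graph* if $\Delta^{X,\mathrm{re}}\subseteq\mathbb N_0^I\cup-\mathbb N_0^I$ for all $X$, and $(r_ir_j)^{m^X_{ij}}(X)=X$ whenever $m_{ij}^X<\infty$. A family $(R^X)_{X\in\mathcal X}$ of subsets of $\mathbb Z^I$ is a *root system* over $\mathcal G$ if $0\notin R^X$, $\alpha_i\in R^X$, $R^X\subseteq\mathbb N_0^I\cup-\mathbb N_0^I$, $s_i^X(R^X)=R^{r_i(X)}$, and $(r_ir_j)^{m^X_{ij}}(X)=X$ whenever $i\ne j$ and $m^X_{ij}<\infty$; it is *reduced* if for every $\alpha\in R^X$ the only rational multiples of $\alpha$ in $R^X$ are $\pm\alpha$. A generalized Cartan matrix $A$ is *affine* if it is indecomposable, has corank $1$, there is a real vector $u$ with all entries positive and $Au=0$, and $Aw\ge 0$ implies $Aw=0$ for real vectors $w$. **Tits cone.** Let $\mathcal G$ be connected and simply connected, fix $M\in\mathcal X$, let $V$ be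 a real vector space of dimension $|I|$, $(\phi_i)_{i\in I}$ a basis of $V^*$, and $\psi:\mathbb Z^I\to V^*$ the additive map with $\psi(\alpha_i)=\phi_i$. For $X\in\mathcal X$ let $w_X$ be the unique morphism $M\to X$ of $\mathcal W(\mathcal G)$, and let $K^X=\{x\in V\mid \psi(w_X^{-1}(\alpha_i))(x)>0\text{ for all }i\in I\}$ be the chamber at $X$. The Tits cone is $T=\operatorname{conv}\bigl(\bigcup_{X\in\mathcal X}K^X\bigr)$. **Proposition.** Let $\mathcal G$ be a connected, simply connected, standard Cartan graph such that $(\Delta^{X,\mathrm{re}})_{X\in\mathcal X}$ is a reduced root system over $\mathcal G$, and suppose that its Cartan matrix $A$ is affine. Then there is an integer vector $v=(v_i)_{i\in I}$ with all $v_i>0$ and $Av=0$ (that is, $\sum_j a_{ij}v_j=0$ for all $i$), and for every such $v$ the Tits cone is the open half-space $$T=\delta^+=\{x\in V\mid \delta(x)>0\},\qquad \delta=\sum_{i\in I}v_i\phi_i .$$ -/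

import Mathlib

open scoped Matrix

/-- Generalized Cartan matrices. -/
structure IsGeneralizedCartanMatrix {I : Type*} (A : Matrix I I ℤ) : Prop where
  diag : ∀ i, A i i = 2
  offDiag : ∀ i j, i ≠ j → A i j ≤ 0
  zero_symm : ∀ i j, A i j = 0 → A j i = 0

/-- A matrix is indecomposable if the index set has no partition into two non-empty subsets
for which both off-diagonal blocks vanish. -/
def IsIndecomposableMatrix {I : Type*} (A : Matrix I I ℤ) : Prop :=
  ∀ S : Set I, S.Nonempty → Sᶜ.Nonempty → ∃ i ∈ S, ∃ j ∈ Sᶜ, A i j ≠ 0 ∨ A j i ≠ 0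

/-- Generalized Cartan matrices of affine type: indecomposable, of corank one, with a strictly
positive real vector `u` such that `A u = 0`, and such that `A w ≥ 0` implies `A w = 0`. -/
structure IsAffineCartanMatrix {I : Type*} [Fintype I] (A : Matrix I I ℤ) : Prop where
  isGCM : IsGeneralizedCartanMatrix A
  indecomposable : IsIndecomposableMatrix A
  corank_one : (A.map (fun a : ℤ => (a : ℝ))).rank + 1 = Fintype.card I
  exists_pos_null : ∃ u : I → ℝ, (∀ i, 0 < u i) ∧ A.map (fun a : ℤ => (a : ℝ)) *ᵥ u = 0
  nonneg_imp_zero : ∀ w : I → ℝ, 0 ≤ A.map (fun a : ℤ => (a : ℝ)) *ᵥ w →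
    A.map (fun a : ℤ => (a : ℝ)) *ᵥ w = 0

/-- Semi-Cartan graphs with index set `I` and set of points `P`. -/
structure SemiCartanGraph (I : Type*) (P : Type*) where
  nonempty_index : Nonempty I
  nonempty_points : Nonempty P
  /-- the reflection maps `r_i` on points -/
  r : I → P → P
  /-- the Cartan matrix `A^X` at the point `X` -/
  A : P → Matrix I I ℤ
  isGCM : ∀ X, IsGeneralizedCartanMatrix (A X)
  r_r : ∀ i X, r i (r i X) = X
  row_eq : ∀ i X j, A (r i X) i j = A X i j

namespace SemiCartanGraph

/-- Standard semi-Cartan graphs: all points have the same Cartan matrix. -/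
def IsStandard {I : Type*} {P : Type*} (G : SemiCartanGraph I P) : Prop :=
  ∀ X Y, G.A X = G.A Y

variable {I : Type*} {P : Type*} [Fintype I] [DecidableEq I]

/-- The simple reflection `s_i^X` of `ℤ^I`, namely `y ↦ y - (A^X y)_i α_i`, where `α_i` is the
`i`-th standard basis vector. -/
def s (G : SemiCartanGraph I P) (i : I) (X : P) : (I → ℤ) ≃ₗ[ℤ] (I → ℤ) :=
  Module.reflection (x := (Pi.single i 1 : I → ℤ))
    (f := (LinearMap.proj i : (I → ℤ) →ₗ[ℤ] ℤ) ∘ₗ (G.A X).mulVecLin)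
    (by simp [(G.isGCM X).diag i])

/-- The defining formula `s_i^X (α_j) = α_j - a_{ij}^X α_i`. -/
theorem s_single (G : SemiCartanGraph I P) (i j : I) (X : P) :
    G.s i X (Pi.single j 1) = Pi.single j 1 - G.A X i j • Pi.single i 1 := by
  simp [s, Module.reflection_apply]

/-- `G.Hom X Y f` says that `(Y, f, X)` is a morphism `X → Y` of the Weyl groupoid of `G`, the
smallest category with set of objects `P` which contains all `(r_i(X), s_i^X, X)`.  The generators
are automorphisms of `ℤ^I`, hence so are all morphisms, and `f` is taken in `Aut(ℤ^I)`. -/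
inductive Hom (G : SemiCartanGraph I P) : P → P → ((I → ℤ) ≃ₗ[ℤ] (I → ℤ)) → Prop
  | id (X : P) : Hom G X X (LinearEquiv.refl ℤ (I → ℤ))
  | gen (i : I) (X : P) : Hom G X (G.r i X) (G.s i X)
  | comp {X Y Z : P} {f g : (I → ℤ) ≃ₗ[ℤ] (I → ℤ)} :
      Hom G X Y f → Hom G Y Z g → Hom G X Z (f.trans g)

/-- Connectedness: any two points are joined by a morphism of the Weyl groupoid. -/
def Connected (G : SemiCartanGraph I P) : Prop :=
  ∀ X Y : P, ∃ f, G.Hom X Y f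

/-- Simple connectedness: there is at most one morphism between any two points. -/
def SimplyConnected (G : SemiCartanGraph I P) : Prop :=
  ∀ (X Y : P) (f g : (I → ℤ) ≃ₗ[ℤ] (I → ℤ)), G.Hom X Y f → G.Hom X Y g → f = g

/-- The set of real roots at `X`: all `w(α_i)` where `w` is a morphism with target `X`. -/
def realRoots (G : SemiCartanGraph I P) (X : P) : Set (I → ℤ) :=
  {a | ∃ (Y : P) (w : (I → ℤ) ≃ₗ[ℤ] (I → ℤ)) (i : I), G.Hom Y X w ∧ a = w (Pi.single i 1)}

/-- The set `Δ^{X,re} ∩ (ℕ α_i + ℕ α_j)`, whose cardinality is `m_{ij}^X`. -/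
def rankTwoRoots (G : SemiCartanGraph I P) (X : P) (i j : I) : Set (I → ℤ) :=
  {a ∈ G.realRoots X |
    ∃ m n : ℕ, a = (m : ℤ) • Pi.single i (1 : ℤ) + (n : ℤ) • Pi.single j (1 : ℤ)}

/-- Cartan graphs: real roots are positive or negative, and `(r_i r_j)^m (X) = X` whenever
`m = m_{ij}^X` is finite. -/
structure IsCartanGraph (G : SemiCartanGraph I P) : Prop where
  pos_or_neg : ∀ X, ∀ a ∈ G.realRoots X, 0 ≤ a ∨ a ≤ 0
  coxeter : ∀ X i j, (G.rankTwoRoots X i j).Finite →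
    (fun Y => G.r i (G.r j Y))^[(G.rankTwoRoots X i j).ncard] X = X

/-- A root system over a semi-Cartan graph. -/
structure IsRootSystem (G : SemiCartanGraph I P) (R : P → Set (I → ℤ)) : Prop where
  zero_notMem : ∀ X, 0 ∉ R X
  simple_mem : ∀ X i, Pi.single i 1 ∈ R X
  pos_or_neg : ∀ X, ∀ a ∈ R X, 0 ≤ a ∨ a ≤ 0
  image_s : ∀ X i, G.s i X '' R X = R (G.r i X)
  coxeter : ∀ X i j, i ≠ j → (G.rankTwoRoots X i j).Finite →
    (fun Y => G.r i (G.r j Y))^[(G.rankTwoRoots X i j).ncard] X = X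

/-- A reduced root system: the only rational multiples of a root `a` which are roots
are `a` and `-a`. -/
def IsReducedRootSystem (G : SemiCartanGraph I P) (R : P → Set (I → ℤ)) : Prop :=
  G.IsRootSystem R ∧ ∀ X, ∀ a ∈ R X,
    {b ∈ R X | ∃ q : ℚ, ∀ i, (b i : ℚ) = q * (a i : ℚ)} = {a, -a}

/-- The morphism `w_B : M → B` of the Weyl groupoid of a connected semi-Cartan graph. It is unique
if the graph is simply connected. -/
noncomputable def pathTo (G : SemiCartanGraph I P) (hG : G.Connected) (M B : P) :
    (I → ℤ) ≃ₗ[ℤ] (I → ℤ) :=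
  Classical.choose (hG M B)

variable {V : Type*} [AddCommGroup V] [Module ℝ V]

/-- The root basis at `B`, relative to the base point `M`: the vectors `ψ (w_B⁻¹ α_i)`, where
`ψ : ℤ^I → V*` is the additive map with `ψ α_i = φ_i`. -/
noncomputable def rootBasis (G : SemiCartanGraph I P) (hG : G.Connected) (M : P)
    (φ : Module.Basis I ℝ (Module.Dual ℝ V)) (B : P) (i : I) : Module.Dual ℝ V :=
  Fintype.linearCombination ℤ (φ : I → Module.Dual ℝ V) ((G.pathTo hG M B).symm (Pi.single i 1))

/-- The chamber at `B`, relative to the base point `M`. -/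
def chamber (G : SemiCartanGraph I P) (hG : G.Connected) (M : P)
    (φ : Module.Basis I ℝ (Module.Dual ℝ V)) (B : P) : Set V :=
  {x | ∀ i, 0 < G.rootBasis hG M φ B i x}

/-- The Tits cone: the convex hull of the union of all chambers. -/
def titsCone (G : SemiCartanGraph I P) (hG : G.Connected) (M : P)
    (φ : Module.Basis I ℝ (Module.Dual ℝ V)) : Set V :=
  convexHull ℝ (⋃ B : P, G.chamber hG M φ B)

end SemiCartanGraph

/-! In the coordinates `φ i x` the chambers are the images of the open positive orthant under the
dual action of the monoid W generated by the simple reflections. W fixes `v`, so `δ` is positive on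
every chamber and hence on T.

Conversely, a point outside the open convex cone T is separated from it by a linear form w. Scaling
forces w to be non-negative on all chambers, that is, the whole W-orbit of w is non-negative. The
crux, `mulVec_eq_zero_of_mem_nonnegOrbitCone`, is that such a w is null; by corank one it is then a
non-negative multiple of `v`, which cannot separate a point with δ > 0.

For integral w, an orbit element of least height is antidominant, hence null by affineness. So the
rational points of the cone C of all such w are null, and density gives C empty interior. A non-null
w in C would, by indecomposability, make C span everything, and a spanning convex cone has interior.
-/

/-- The extension of scalars of an integer matrix to the real numbers. -/
abbrev realMatrix {I : Type*} (A : Matrix I I ℤ) : Matrix I I ℝ :=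
  A.map (fun a : ℤ => (a : ℝ))

theorem realMatrix_mulVec_intCast {I : Type*} [Fintype I] (A : Matrix I I ℤ) (p : I → ℤ) :
    realMatrix A *ᵥ (fun j => (p j : ℝ)) = fun i => ((A *ᵥ p) i : ℝ) := by
  ext i
  simp [Matrix.mulVec, dotProduct]

/-! ### The null line of an affine Cartan matrix -/

namespace IsAffineCartanMatrix

variable {I : Type*} [Fintype I] {A : Matrix I I ℤ}

theorem det_eq_zero [DecidableEq I] (hA : IsAffineCartanMatrix A) [Nonempty I] : A.det = 0 := by
  obtain ⟨u, hu, hAu⟩ := hA.exists_pos_null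
  have h : (realMatrix A).det = 0 := by
    rw [← Matrix.exists_mulVec_eq_zero_iff]
    refine ⟨u, fun h => ?_, hAu⟩
    have i := Classical.arbitrary I
    exact (hu i).ne' (congrFun h i)
  have h2 := Int.cast_det (R := ℝ) A
  rw [← @Int.cast_inj ℝ, h2, Int.cast_zero]
  exact h

/-- The real null space of an affine Cartan matrix is a line. -/
theorem exists_smul_eq_of_mulVec_eq_zero (hA : IsAffineCartanMatrix A) {u w : I → ℝ}
    (hu0 : u ≠ 0) (hu : realMatrix A *ᵥ u = 0) (hw : realMatrix A *ᵥ w = 0) :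
    ∃ c : ℝ, w = c • u := by
  have h1 := hA.corank_one
  have h2 := (realMatrix A).mulVecLin.finrank_range_add_finrank_ker
  have h3 : (realMatrix A).rank = Module.finrank ℝ (realMatrix A).mulVecLin.range := rfl
  rw [Module.finrank_fintype_fun_eq_card] at h2
  have h4 : Module.finrank ℝ (realMatrix A).mulVecLin.ker = 1 := by
    have h1' : (realMatrix A).rank + 1 = Fintype.card I := h1
    omega
  obtain ⟨c, hc⟩ := (finrank_eq_one_iff_of_nonzero'
    (⟨u, by simpa using hu⟩ : (realMatrix A).mulVecLin.ker) (by simpa using hu0)).1 h4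
    ⟨w, by simpa using hw⟩
  exact ⟨c, by simpa using (congrArg Subtype.val hc).symm⟩

/-- A singular integer matrix has a non-zero integral null vector; it is proportional to the
positive real one, so up to sign it is positive. -/
theorem exists_pos_int_null [DecidableEq I] [Nonempty I] (hA : IsAffineCartanMatrix A) :
    ∃ v : I → ℤ, (∀ i, 0 < v i) ∧ A *ᵥ v = 0 := by
  obtain ⟨v, hv0, hv⟩ := Matrix.exists_mulVec_eq_zero_iff.2 hA.det_eq_zero
  obtain ⟨u, hu, hAu⟩ := hA.exists_pos_null
  have i₀ := Classical.arbitrary I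
  obtain ⟨c, hc⟩ := hA.exists_smul_eq_of_mulVec_eq_zero (u := u) (w := fun j => (v j : ℝ))
    (fun h => (hu i₀).ne' (congrFun h i₀)) hAu
    (by rw [realMatrix_mulVec_intCast, hv]; ext; simp)
  have hc' : ∀ i, (v i : ℝ) = c * u i := fun i => congrFun hc i
  rcases lt_trichotomy c 0 with h | h | h
  · refine ⟨-v, fun i => ?_, by simp [Matrix.mulVec_neg, hv]⟩
    have : (v i : ℝ) < 0 := by rw [hc']; exact mul_neg_of_neg_of_pos h (hu i)
    simpa using (by exact_mod_cast this : v i < 0)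
  · refine absurd (funext fun i => ?_) hv0
    have := hc' i
    rw [h, zero_mul] at this
    exact_mod_cast this
  · refine ⟨v, fun i => ?_, hv⟩
    have : 0 < (v i : ℝ) := by rw [hc']; exact mul_pos h (hu i)
    exact_mod_cast this

end IsAffineCartanMatrix

/-! ### Reflections acting on `ℝ^I` -/

section RealRep

variable {I : Type*} [Fintype I] [DecidableEq I]

/-- The action of `Aut(ℤ^I)` on `ℝ^I` by matrices. -/
def realRep : ((I → ℤ) ≃ₗ[ℤ] (I → ℤ)) →* Matrix I I ℝ where
  toFun f := realMatrix (LinearMap.toMatrix' f.toLinearMap)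
  map_one' := by
    change realMatrix (LinearMap.toMatrix' (LinearMap.id)) = 1
    rw [LinearMap.toMatrix'_id]
    exact Matrix.map_one _ (by simp) (by simp)
  map_mul' f g := by
    change realMatrix (LinearMap.toMatrix' (f.toLinearMap.comp g.toLinearMap)) = _
    rw [LinearMap.toMatrix'_comp]
    exact Matrix.map_mul (f := Int.castRingHom ℝ)

theorem realRep_apply (f : (I → ℤ) ≃ₗ[ℤ] (I → ℤ)) (k j : I) :
    realRep f k j = (f (Pi.single j 1) k : ℝ) := by
  simp [realRep, LinearMap.toMatrix'_apply]

theorem realRep_mulVec_intCast (f : (I → ℤ) ≃ₗ[ℤ] (I → ℤ)) (p : I → ℤ) :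
    realRep f *ᵥ (fun j => (p j : ℝ)) = fun i => (f p i : ℝ) := by
  have h := realMatrix_mulVec_intCast (LinearMap.toMatrix' f.toLinearMap) p
  rw [LinearMap.toMatrix'_mulVec] at h
  exact h

theorem realRep_inv_mulVec_mulVec (f : (I → ℤ) ≃ₗ[ℤ] (I → ℤ)) (w : I → ℝ) :
    realRep f⁻¹ *ᵥ realRep f *ᵥ w = w := by
  rw [Matrix.mulVec_mulVec, ← map_mul, inv_mul_cancel, map_one, Matrix.one_mulVec]

namespace SemiCartanGraph

variable {P : Type*}

theorem s_apply (G : SemiCartanGraph I P) (i : I) (X : P) (p : I → ℤ) :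
    G.s i X p = p - Pi.single i ((G.A X *ᵥ p) i) := by
  rw [s, Module.reflection_apply]
  ext k
  by_cases h : k = i
  · subst h; simp
  · simp [h]

theorem realRep_s_mulVec (G : SemiCartanGraph I P) (i : I) (X : P) (w : I → ℝ) :
    realRep (G.s i X) *ᵥ w = w - Pi.single i ((realMatrix (G.A X) *ᵥ w) i) := by
  ext k
  simp only [Matrix.mulVec, dotProduct, realRep_apply, s_single, Pi.sub_apply, Pi.smul_apply,
    Int.cast_sub, sub_mul, Finset.sum_sub_distrib, smul_eq_mul, Matrix.map_apply]
  by_cases h : k = i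
  · subst h; simp [Pi.single_apply]
  · simp [h, Pi.single_apply]

/-- The monoid generated by the simple reflections at a point. -/
def reflectionMonoid (G : SemiCartanGraph I P) (X : P) :
    Submonoid ((I → ℤ) ≃ₗ[ℤ] (I → ℤ)) :=
  Submonoid.closure (Set.range fun i => G.s i X)

theorem s_mem_reflectionMonoid (G : SemiCartanGraph I P) (i : I) (X : P) :
    G.s i X ∈ G.reflectionMonoid X :=
  Submonoid.subset_closure ⟨i, rfl⟩

theorem IsStandard.s_eq {G : SemiCartanGraph I P} (hG : G.IsStandard) (i : I) (X Y : P) :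
    G.s i X = G.s i Y := by
  ext j : 1
  ext k
  simp [s_apply, hG X Y]

theorem IsStandard.mem_reflectionMonoid_of_hom {G : SemiCartanGraph I P} (hG : G.IsStandard)
    (M : P) {X Y : P} {f : (I → ℤ) ≃ₗ[ℤ] (I → ℤ)} (hf : G.Hom X Y f) :
    f ∈ G.reflectionMonoid M := by
  induction hf with
  | id X => exact one_mem _
  | gen i X => rw [hG.s_eq i X M]; exact G.s_mem_reflectionMonoid i M
  | comp _ _ h1 h2 => exact mul_mem h2 h1

/-- Reflections do not depend on the point, so any word in them can be read as a path starting at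
`M`. -/
theorem IsStandard.exists_hom {G : SemiCartanGraph I P} (hG : G.IsStandard) {M : P}
    {f : (I → ℤ) ≃ₗ[ℤ] (I → ℤ)} (hf : f ∈ G.reflectionMonoid M) : ∃ B, G.Hom M B f := by
  induction hf using Submonoid.closure_induction_left with
  | one => exact ⟨M, .id M⟩
  | mul_left x hx y hy ih =>
    obtain ⟨i, rfl⟩ := hx
    obtain ⟨B, hB⟩ := ih
    refine ⟨G.r i B, ?_⟩
    change G.Hom M _ (G.s i M * y)
    rw [hG.s_eq i M B]
    exact hB.comp (.gen i B)

/-- Null vectors of the Cartan matrix are invariant under the reflections. -/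
theorem realRep_mulVec_eq_self (G : SemiCartanGraph I P) {X : P} {w : I → ℝ}
    (hw : realMatrix (G.A X) *ᵥ w = 0) {f : (I → ℤ) ≃ₗ[ℤ] (I → ℤ)}
    (hf : f ∈ G.reflectionMonoid X) : realRep f *ᵥ w = w := by
  induction hf using Submonoid.closure_induction with
  | one => simp
  | mem f hf =>
    obtain ⟨i, rfl⟩ := hf
    simp [realRep_s_mulVec, hw]
  | mul f g _ _ hf hg => rw [map_mul, ← Matrix.mulVec_mulVec, hg, hf]

/-! ### Vectors with non-negative orbit are null -/

/-- The cone of vectors whose whole orbit under the reflections is non-negative. -/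
def nonnegOrbitCone (G : SemiCartanGraph I P) (X : P) : Set (I → ℝ) :=
  {w | ∀ f ∈ G.reflectionMonoid X, 0 ≤ realRep f *ᵥ w}

theorem realRep_mulVec_mem_nonnegOrbitCone (G : SemiCartanGraph I P) {X : P} {w : I → ℝ}
    (hw : w ∈ G.nonnegOrbitCone X) {f : (I → ℤ) ≃ₗ[ℤ] (I → ℤ)}
    (hf : f ∈ G.reflectionMonoid X) : realRep f *ᵥ w ∈ G.nonnegOrbitCone X := fun g hg => by
  rw [Matrix.mulVec_mulVec, ← map_mul]
  exact hw _ (mul_mem hg hf)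

theorem smul_mem_nonnegOrbitCone (G : SemiCartanGraph I P) {X : P} {w : I → ℝ} {c : ℝ}
    (hc : 0 ≤ c) (hw : w ∈ G.nonnegOrbitCone X) : c • w ∈ G.nonnegOrbitCone X := fun f hf => by
  rw [Matrix.mulVec_smul]
  exact smul_nonneg hc (hw f hf)

theorem convex_nonnegOrbitCone (G : SemiCartanGraph I P) (X : P) :
    Convex ℝ (G.nonnegOrbitCone X) := fun x hx y hy a b ha hb _ f hf => by
  rw [Matrix.mulVec_add, Matrix.mulVec_smul, Matrix.mulVec_smul]
  exact add_nonneg (smul_nonneg ha (hx f hf)) (smul_nonneg hb (hy f hf))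

/-- An integral vector whose orbit is non-negative is a null vector: an element of the orbit with
minimal coordinate sum is antidominant. -/
theorem mulVec_eq_zero_of_intCast_mem_nonnegOrbitCone (G : SemiCartanGraph I P) {X : P}
    (hA : IsAffineCartanMatrix (G.A X)) {p : I → ℤ}
    (hp : (fun j => (p j : ℝ)) ∈ G.nonnegOrbitCone X) :
    realMatrix (G.A X) *ᵥ (fun j => (p j : ℝ)) = 0 := by
  have hnn : ∀ f ∈ G.reflectionMonoid X, ∀ i, 0 ≤ f p i := fun f hf i => by
    have h := hp f hf
    rw [realRep_mulVec_intCast] at h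
    exact Int.cast_nonneg_iff.1 (h i)
  obtain ⟨f, hf, hmin⟩ : ∃ f ∈ G.reflectionMonoid X, ∀ g ∈ G.reflectionMonoid X,
      ∑ i, f p i ≤ ∑ i, g p i := by
    -- Truncation by `toNat` is harmless: all these sums are non-negative.
    let e : G.reflectionMonoid X → ℕ := fun f => (∑ i, f.1 p i).toNat
    obtain ⟨f, hf⟩ := (wellFounded_lt.onFun (f := e)).has_min Set.univ ⟨1, trivial⟩
    refine ⟨f.1, f.2, fun g hg => ?_⟩
    have h1 := hf.2 ⟨g, hg⟩ trivial
    have h2 : 0 ≤ ∑ i, g p i := Finset.sum_nonneg fun i _ => hnn g hg i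
    have h3 : ¬ (∑ i, g p i).toNat < (∑ i, f.1 p i).toNat := h1
    omega
  -- Applying `s_i` lowers the coordinate sum by exactly this entry, so minimality makes it
  -- non-positive.
  have hneg : ∀ i, (G.A X *ᵥ f p) i ≤ 0 := fun i => by
    have h := hmin _ (mul_mem (G.s_mem_reflectionMonoid i X) hf)
    rw [LinearEquiv.mul_apply, s_apply] at h
    simp only [Pi.sub_apply, Finset.sum_sub_distrib] at h
    simpa using h
  have hzero : realMatrix (G.A X) *ᵥ (fun j => (f p j : ℝ)) = 0 := by
    have h := hA.nonneg_imp_zero (-fun j => (f p j : ℝ)) (by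
      rw [Matrix.mulVec_neg, realMatrix_mulVec_intCast]
      intro i
      simpa using hneg i)
    rwa [Matrix.mulVec_neg, neg_eq_zero] at h
  have hfix := G.realRep_mulVec_eq_self hzero hf
  have hp' : (fun j => (p j : ℝ)) = fun j => (f p j : ℝ) := by
    rw [← realRep_inv_mulVec_mulVec f fun j => (p j : ℝ), realRep_mulVec_intCast]
    nth_rw 1 [← hfix]
    rw [realRep_inv_mulVec_mulVec]
  rw [hp', hzero]

/-- A cone of vectors with non-negative orbits has empty interior. -/
theorem interior_nonnegOrbitCone (G : SemiCartanGraph I P) {X : P}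
    (hA : IsAffineCartanMatrix (G.A X)) : interior (G.nonnegOrbitCone X) = ∅ := by
  by_contra hne
  have hne := Set.nonempty_iff_ne_empty.2 hne
  have hrat : ∀ q : I → ℚ, (fun j => (q j : ℝ)) ∈ G.nonnegOrbitCone X →
      (fun j => (q j : ℝ)) ∈ (realMatrix (G.A X)).mulVecLin.ker := fun q hq => by
    obtain ⟨N, hN⟩ := IsLocalization.exist_integer_multiples_of_finset (nonZeroDivisors ℤ)
      (Finset.univ.image q)
    have hN0 : (N : ℤ) ≠ 0 := nonZeroDivisors.ne_zero N.2
    have hp : ∀ j, ∃ p : ℤ, (p : ℚ) = (N : ℤ) * q j := fun j => by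
      obtain ⟨p, hp⟩ := hN (q j) (Finset.mem_image_of_mem q (Finset.mem_univ j))
      exact ⟨p, by simpa using hp⟩
    choose p hp using hp
    have hpr : ∀ j, (p j : ℝ) = ((N : ℤ) : ℝ) * q j := fun j => by exact_mod_cast hp j
    -- The second factor `N` makes the scalar `N²`, non-negative whatever the sign of `N`.
    have hmem : (fun j => ((((N : ℤ) * p j : ℤ)) : ℝ)) ∈ G.nonnegOrbitCone X := by
      convert G.smul_mem_nonnegOrbitCone (sq_nonneg (((N : ℤ)) : ℝ)) hq using 1
      ext j
      simp [hpr, sq, mul_assoc]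
    have h0 := G.mulVec_eq_zero_of_intCast_mem_nonnegOrbitCone hA hmem
    have heq : (fun j => ((((N : ℤ) * p j : ℤ)) : ℝ)) =
        ((((N : ℤ)) : ℝ) ^ 2) • fun j => (q j : ℝ) := by
      ext j
      simp [hpr, sq, mul_assoc]
    rw [heq, Matrix.mulVec_smul, smul_eq_zero] at h0
    have hN0' : (((N : ℤ)) : ℝ) ^ 2 ≠ 0 := pow_ne_zero _ (by exact_mod_cast hN0)
    simpa using h0.resolve_left hN0'
  have hdense : DenseRange (fun (q : I → ℚ) (j : I) => (q j : ℝ)) :=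
    DenseRange.piMap fun _ => Rat.denseRange_cast
  have hsub : interior (G.nonnegOrbitCone X) ⊆ (realMatrix (G.A X)).mulVecLin.ker := by
    refine (hdense.open_subset_closure_inter isOpen_interior).trans ?_
    refine closure_minimal ?_ (Submodule.closed_of_finiteDimensional _)
    rintro _ ⟨hq, q, rfl⟩
    exact hrat q (interior_subset hq)
  have htop := Submodule.eq_top_of_nonempty_interior' _
    (hne.mono (interior_maximal hsub isOpen_interior))
  obtain ⟨i⟩ := G.nonempty_index
  have hi : (Pi.single i 1 : I → ℝ) ∈ (realMatrix (G.A X)).mulVecLin.ker := htop ▸ trivial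
  have h2 := congrFun (LinearMap.mem_ker.1 hi) i
  simp [(G.isGCM X).diag i] at h2

/-- A vector whose orbit is non-negative is a null vector of the affine Cartan matrix. -/
theorem mulVec_eq_zero_of_mem_nonnegOrbitCone (G : SemiCartanGraph I P) {X : P}
    (hA : IsAffineCartanMatrix (G.A X)) {w : I → ℝ} (hw : w ∈ G.nonnegOrbitCone X) :
    realMatrix (G.A X) *ᵥ w = 0 := by
  by_contra hne
  obtain ⟨i₀, hi₀⟩ := Function.ne_iff.1 hne
  set U := Submodule.span ℝ (G.nonnegOrbitCone X) with hU
  -- The span is stable under reflections, and `u - s_i u = (A u)_i α_i`.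
  have hstep : ∀ u ∈ U, ∀ i, (realMatrix (G.A X) *ᵥ u) i • (Pi.single i 1 : I → ℝ) ∈ U := by
    intro u hu i
    have h : realRep (G.s i X) *ᵥ u ∈ U := by
      have hle : U ≤ U.comap (realRep (G.s i X)).mulVecLin := Submodule.span_le.2 fun x hx =>
        Submodule.subset_span
          (G.realRep_mulVec_mem_nonnegOrbitCone hx (G.s_mem_reflectionMonoid i X))
      exact hle hu
    have h2 := U.sub_mem hu h
    rw [realRep_s_mulVec, sub_sub_cancel] at h2
    convert h2 using 1
    ext k
    simp [Pi.single_apply]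
  have hmem : ∀ u ∈ U, ∀ i, (realMatrix (G.A X) *ᵥ u) i ≠ 0 → (Pi.single i 1 : I → ℝ) ∈ U :=
    fun u hu i hi => (Submodule.smul_mem_iff _ hi).1 (hstep u hu i)
  -- If `α_i ∈ U` and `a_ji ≠ 0`, then `α_j ∈ U`; indecomposability spreads this to all indices.
  have hall : ∀ i, (Pi.single i 1 : I → ℝ) ∈ U := by
    by_contra! hnot
    obtain ⟨i, hi, j, hj, hij⟩ := hA.indecomposable {i | (Pi.single i 1 : I → ℝ) ∈ U}
      ⟨i₀, hmem w (Submodule.subset_span hw) i₀ hi₀⟩ hnot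
    have hji : G.A X j i ≠ 0 := fun h => hij.elim (fun h' => h' ((G.isGCM X).zero_symm _ _ h))
      fun h' => h' h
    refine hj (hmem _ hi j ?_)
    simpa using hji
  have htop : U = ⊤ := by
    rw [eq_top_iff, ← (Pi.basisFun ℝ I).span_eq, Submodule.span_le]
    rintro _ ⟨i, rfl⟩
    simpa using hall i
  have hzero : (0 : I → ℝ) ∈ G.nonnegOrbitCone X := fun f _ => by simp
  have haff : affineSpan ℝ (G.nonnegOrbitCone X) = ⊤ := by
    rw [AffineSubspace.affineSpan_eq_top_iff_vectorSpan_eq_top_of_nonempty _ _ _ ⟨0, hzero⟩,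
      eq_top_iff, ← htop, hU, Submodule.span_le]
    intro x hx
    simpa using vsub_mem_vectorSpan ℝ hx hzero
  have hint := (G.convex_nonnegOrbitCone X).interior_nonempty_iff_affineSpan_eq_top.2 haff
  rw [G.interior_nonnegOrbitCone hA] at hint
  exact Set.not_nonempty_empty hint

end SemiCartanGraph

end RealRep

/-! ### Chambers in coordinates and separation -/

section RealRep

variable {I : Type*} [Fintype I] [DecidableEq I]

/-- The chamber of an automorphism of `ℤ^I`, in the coordinates given by the simple roots. -/
def coordChamber (f : (I → ℤ) ≃ₗ[ℤ] (I → ℤ)) : Set (I → ℝ) :=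
  {y | ∀ i, 0 < (y ᵥ* realRep f⁻¹) i}

theorem isOpen_coordChamber (f : (I → ℤ) ≃ₗ[ℤ] (I → ℤ)) : IsOpen (coordChamber f) := by
  have h : coordChamber f = ⋂ i, {y | 0 < (y ᵥ* realRep f⁻¹) i} := by
    ext y
    simp [coordChamber]
  rw [h]
  refine isOpen_iInter_of_finite fun i => isOpen_lt continuous_const ?_
  exact (continuous_apply i).comp (LinearMap.continuous_of_finiteDimensional
    (realRep f⁻¹).vecMulLinear)

theorem vecMul_mem_coordChamber (f : (I → ℤ) ≃ₗ[ℤ] (I → ℤ)) {z : I → ℝ} (hz : ∀ i, 0 < z i) :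
    z ᵥ* realRep f ∈ coordChamber f := fun i => by
  rw [Matrix.vecMul_vecMul, ← map_mul, mul_inv_cancel, map_one, Matrix.vecMul_one]
  exact hz i

theorem smul_mem_coordChamber (f : (I → ℤ) ≃ₗ[ℤ] (I → ℤ)) {y : I → ℝ} {c : ℝ} (hc : 0 < c)
    (hy : y ∈ coordChamber f) : c • y ∈ coordChamber f := fun i => by
  rw [Matrix.smul_vecMul]
  exact mul_pos hc (hy i)

/-- A vector which pairs non-negatively with all positive vectors is non-negative. -/
theorem nonneg_of_forall_pos_dotProduct_nonneg {w : I → ℝ}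
    (h : ∀ z : I → ℝ, (∀ i, 0 < z i) → 0 ≤ z ⬝ᵥ w) : 0 ≤ w := by
  intro i
  by_contra! hi
  have hi : w i < 0 := hi
  -- The extra weight at `i` turns the pairing into `S - |S| + w i < 0`, where `S = ∑ j, w j`.
  have h1 := h (fun j => 1 + Pi.single (M := fun _ => ℝ) i (|∑ j, w j| / (-w i) + 1) j) fun j => by
    have : 0 ≤ Pi.single (M := fun _ => ℝ) i (|∑ j, w j| / (-w i) + 1) :=
      Pi.single_nonneg.2 (by have := neg_pos.2 hi; positivity)
    linarith [show (0 : ℝ) ≤ _ from this j]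
  have h2 : (fun j => 1 + Pi.single (M := fun _ => ℝ) i (|∑ j, w j| / (-w i) + 1) j) ⬝ᵥ w =
      ∑ j, w j + (|∑ j, w j| / (-w i) + 1) * w i := by
    simp [dotProduct, add_mul, Finset.sum_add_distrib, Pi.single_apply]
  have h3 : |∑ j, w j| / (-w i) * w i = -|∑ j, w j| := by
    rw [div_neg, neg_mul, div_mul_cancel₀ _ hi.ne]
  rw [h2, add_mul, h3] at h1
  linarith [le_abs_self (∑ j, w j)]

namespace SemiCartanGraph

variable {P : Type*}

/-- The union of the chambers of the reflection monoid, in coordinates. -/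
def coordChambers (G : SemiCartanGraph I P) (X : P) : Set (I → ℝ) :=
  ⋃ f ∈ G.reflectionMonoid X, coordChamber f

theorem convexHull_coordChambers_subset (G : SemiCartanGraph I P) {X : P} {v : I → ℝ}
    (hv : ∀ i, 0 < v i) (hAv : realMatrix (G.A X) *ᵥ v = 0) :
    convexHull ℝ (G.coordChambers X) ⊆ {y | 0 < y ⬝ᵥ v} := by
  refine convexHull_min ?_ ?_
  · refine Set.iUnion₂_subset fun f hf y hy => ?_
    have hfix : realRep f⁻¹ *ᵥ v = v := by
      nth_rw 1 [← G.realRep_mulVec_eq_self hAv hf]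
      exact realRep_inv_mulVec_mulVec f v
    have hy' : y ⬝ᵥ v = (y ᵥ* realRep f⁻¹) ⬝ᵥ v := by
      rw [← Matrix.dotProduct_mulVec, hfix]
    have := G.nonempty_index
    rw [Set.mem_ofPred_eq, hy']
    exact Finset.sum_pos (fun i _ => mul_pos (hy i) (hv i)) Finset.univ_nonempty
  · intro x hx y hy a b ha hb hab
    rw [Set.mem_ofPred_eq, add_dotProduct, smul_dotProduct, smul_dotProduct, smul_eq_mul,
      smul_eq_mul]
    rcases ha.eq_or_lt with rfl | ha
    · rw [zero_add] at hab
      subst hab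
      simpa using hy
    · exact add_pos_of_pos_of_nonneg (mul_pos ha hx) (mul_nonneg hb (le_of_lt hy))

/-- A linear form which is non-negative on all chambers has non-negative orbit. -/
theorem mem_nonnegOrbitCone_of_forall (G : SemiCartanGraph I P) {X : P} {w : I → ℝ}
    (hw : ∀ y ∈ G.coordChambers X, 0 ≤ y ⬝ᵥ w) : w ∈ G.nonnegOrbitCone X := fun f hf => by
  refine nonneg_of_forall_pos_dotProduct_nonneg fun z hz => ?_
  rw [Matrix.dotProduct_mulVec]
  exact hw _ (Set.mem_biUnion hf (vecMul_mem_coordChamber f hz))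

/-- The coordinate version of the Tits cone of an affine Cartan matrix is an open half-space. -/
theorem convexHull_coordChambers_eq (G : SemiCartanGraph I P) {X : P}
    (hA : IsAffineCartanMatrix (G.A X)) {v : I → ℝ} (hv : ∀ i, 0 < v i)
    (hAv : realMatrix (G.A X) *ᵥ v = 0) :
    convexHull ℝ (G.coordChambers X) = {y | 0 < y ⬝ᵥ v} := by
  refine (G.convexHull_coordChambers_subset hv hAv).antisymm fun x hx => ?_
  by_contra hxT
  have hopen : IsOpen (G.coordChambers X) := isOpen_biUnion fun f _ => isOpen_coordChamber f
  obtain ⟨g, hg⟩ := geometric_hahn_banach_open_point (convex_convexHull ℝ _) hopen.convexHull hxT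
  obtain ⟨w, hgw⟩ : ∃ w : I → ℝ, ∀ y, g y = -(y ⬝ᵥ w) := by
    refine ⟨fun j => -g (Pi.single j 1), fun y => ?_⟩
    conv_lhs => rw [pi_eq_sum_univ' y, map_sum]
    simp [dotProduct]
  have hlt : ∀ y ∈ G.coordChambers X, x ⬝ᵥ w < y ⬝ᵥ w := fun y hy => by
    have := hg y (subset_convexHull ℝ _ hy)
    rw [hgw, hgw] at this
    linarith
  have hsmul : ∀ c : ℝ, 0 < c → ∀ y ∈ G.coordChambers X, c • y ∈ G.coordChambers X := by
    intro c hc y hy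
    obtain ⟨f, hf, hy⟩ := Set.mem_iUnion₂.1 hy
    exact Set.mem_biUnion hf (smul_mem_coordChamber f hc hy)
  have hscale : ∀ y ∈ G.coordChambers X, ∀ c : ℝ, 0 < c → x ⬝ᵥ w < c * (y ⬝ᵥ w) := by
    intro y hy c hc
    simpa using hlt _ (hsmul c hc y hy)
  have hnonneg : ∀ y ∈ G.coordChambers X, 0 ≤ y ⬝ᵥ w := fun y hy => by
    by_contra! hneg
    -- This scalar moves the pairing to `-(|x ⬝ᵥ w| + 1)`, below `x ⬝ᵥ w`.
    have h1 := hscale y hy ((|x ⬝ᵥ w| + 1) / -(y ⬝ᵥ w))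
      (div_pos (by positivity) (neg_pos.2 hneg))
    have h2 : (|x ⬝ᵥ w| + 1) / -(y ⬝ᵥ w) * (y ⬝ᵥ w) = -(|x ⬝ᵥ w| + 1) := by
      rw [div_neg, neg_mul, div_mul_cancel₀ _ hneg.ne]
    linarith [neg_abs_le (x ⬝ᵥ w)]
  obtain ⟨i⟩ := G.nonempty_index
  obtain ⟨c, rfl⟩ := hA.exists_smul_eq_of_mulVec_eq_zero (fun h => (hv i).ne' (congrFun h i)) hAv
    (G.mulVec_eq_zero_of_mem_nonnegOrbitCone hA (G.mem_nonnegOrbitCone_of_forall hnonneg))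
  have hone : (1 : I → ℝ) ∈ G.coordChambers X :=
    Set.mem_biUnion (one_mem _) (fun i => by simp)
  have h1v : 0 < (1 : I → ℝ) ⬝ᵥ v :=
    G.convexHull_coordChambers_subset hv hAv (subset_convexHull ℝ _ hone)
  have hcone := hnonneg _ hone
  have hclt := hlt _ hone
  simp only [dotProduct_smul, smul_eq_mul] at hcone hclt
  have hx : 0 < x ⬝ᵥ v := hx
  have hc : 0 ≤ c := nonneg_of_mul_nonneg_left hcone h1v
  have h2 := hscale _ hone
  rcases hc.eq_or_lt with rfl | hc
  · simp at hclt
  -- The all-ones vector is scaled until its pairing equals that of `x`, against strict separation.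
  · have h3 := h2 (c * (x ⬝ᵥ v) / (c * ((1 : I → ℝ) ⬝ᵥ v))) (by positivity)
    simp only [dotProduct_smul, smul_eq_mul] at h3
    rw [div_mul_cancel₀ _ (by positivity)] at h3
    exact lt_irrefl _ h3

/-! ### Transfer to `V` -/

variable {V : Type*} [AddCommGroup V] [Module ℝ V]

/-- The coordinates on `V` given by a basis of the dual space. -/
noncomputable def dualCoord (φ : Module.Basis I ℝ (Module.Dual ℝ V)) : V ≃ₗ[ℝ] (I → ℝ) :=
  haveI : FiniteDimensional ℝ (Module.Dual ℝ V) := φ.finiteDimensional_of_finite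
  haveI : FiniteDimensional ℝ V := Module.finite_dual_iff ℝ |>.1 inferInstance
  (Module.evalEquiv ℝ V).trans (φ.constr ℝ).symm

theorem dualCoord_apply (φ : Module.Basis I ℝ (Module.Dual ℝ V)) (x : V) (i : I) :
    dualCoord φ x i = φ i x := by
  simp [dualCoord, Module.Basis.constr]

theorem rootBasis_apply (G : SemiCartanGraph I P) (hG : G.Connected) (M : P)
    (φ : Module.Basis I ℝ (Module.Dual ℝ V)) (B : P) (i : I) (x : V) :
    G.rootBasis hG M φ B i x = (dualCoord φ x ᵥ* realRep (G.pathTo hG M B)⁻¹) i := by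
  simp [rootBasis, Fintype.linearCombination_apply, Matrix.vecMul, dotProduct, dualCoord_apply,
    realRep_apply, mul_comm]

/-- Every monoid element is a morphism from `M` to some `B`; simple connectedness makes it the
chosen `pathTo`. -/
theorem iUnion_chamber_eq (G : SemiCartanGraph I P) (hG : G.Connected)
    (hsimply : G.SimplyConnected) (hstd : G.IsStandard) (M : P)
    (φ : Module.Basis I ℝ (Module.Dual ℝ V)) :
    dualCoord φ '' (⋃ B : P, G.chamber hG M φ B) = G.coordChambers M := by
  have hpath : ∀ B, G.Hom M B (G.pathTo hG M B) := fun B => Classical.choose_spec (hG M B)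
  rw [LinearEquiv.image_eq_preimage_symm]
  ext y
  simp only [Set.mem_preimage, Set.mem_iUnion, coordChambers, exists_prop, chamber,
    Set.mem_ofPred_eq, rootBasis_apply, LinearEquiv.apply_symm_apply]
  constructor
  · rintro ⟨B, hB⟩
    exact ⟨_, hstd.mem_reflectionMonoid_of_hom M (hpath B), hB⟩
  · rintro ⟨f, hf, hy⟩
    obtain ⟨B, hB⟩ := hstd.exists_hom hf
    exact ⟨B, hsimply _ _ _ _ hB (hpath B) ▸ hy⟩

theorem titsCone_eq (G : SemiCartanGraph I P) (hG : G.Connected)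
    (hsimply : G.SimplyConnected) (hstd : G.IsStandard) (M : P)
    (φ : Module.Basis I ℝ (Module.Dual ℝ V)) :
    G.titsCone hG M φ = dualCoord φ ⁻¹' convexHull ℝ (G.coordChambers M) := by
  rw [← G.iUnion_chamber_eq hG hsimply hstd M φ]
  have h := (dualCoord φ).toLinearMap.image_convexHull (⋃ B : P, G.chamber hG M φ B)
  rw [LinearEquiv.coe_coe] at h
  rw [← h, Set.preimage_image_eq _ (dualCoord φ).injective]
  rfl

end SemiCartanGraph

end RealRep

theorem mainTheorem9 {I P V : Type*} [Fintype I] [DecidableEq I]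
    [AddCommGroup V] [Module ℝ V]
    (G : SemiCartanGraph I P)
    (hCartan : G.IsCartanGraph)
    (hconn : G.Connected)
    (hsimply : G.SimplyConnected)
    (hstd : G.IsStandard)
    (hroot : G.IsReducedRootSystem G.realRoots)
    (M : P)
    (haffine : IsAffineCartanMatrix (G.A M))
    (φ : Module.Basis I ℝ (Module.Dual ℝ V)) :
    (∃ v : I → ℤ, (∀ i, 0 < v i) ∧ G.A M *ᵥ v = 0) ∧
    ∀ v : I → ℤ, (∀ i, 0 < v i) → G.A M *ᵥ v = 0 →
      G.titsCone hconn M φ = {x : V | 0 < (∑ i, v i • φ i) x} := by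
  have := G.nonempty_index
  refine ⟨haffine.exists_pos_int_null, fun v hv hAv => ?_⟩
  rw [G.titsCone_eq hconn hsimply hstd M φ, G.convexHull_coordChambers_eq haffine
    (v := fun i => (v i : ℝ)) (fun i => Int.cast_pos.2 (hv i))
    (by rw [realMatrix_mulVec_intCast, hAv]; ext; simp)]
  ext x
  simp [dotProduct, SemiCartanGraph.dualCoord_apply, mul_comm]
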